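/- Let $\mathcal H$ be a finite-dimensional complex Hilbert space, $d=\dim\mathcal H$. For a finite sequence $\mathcal V=(v_i)_{i=1}^m$ in $\mathcal H$ let $S_{\mathcal V}=\sum_{i=1}^m v_i\otimes v_i$ be its frame operator, where $(v\otimes v)x=\langle x,v\rangle v$. Let $f:[0,\infty)\to(-\infty,\infty]$ be strictly convex, i.e. $f(sx+(1-s)y)<s f(x)+(1-s)f(y)$ for all $x\neq y$ in $[0,\infty)$ and $0<s<1$ (so $f$ is finite on $(0,\infty)$, and real-valued strictly convex functions on $[0,\infty)$, as well as $f(x)=x^{-1}$ with $f(0)=\infty$, are included). Let $P_f(\mathcal V)=\operatorname{tr} f(S_{\mathcal V})=\sum_{i=1}^d f(\lambda_i(S_{\mathcal V}))$, where the $\lambda_i(S_{\mathcal V})$ are the eigenvalues of $S_{\mathcal V}$ counted with multiplicity. Let $\mathcal F_0$ be a finite sequence of $n_0$ vectors of $\mathcal H$, put $S_0=S_{\mathcal F_0}$, and let $\mathbf a=(\alpha_1,\dots,\alpha_k)$ be a sequence of positive numbers with $d-\operatorname{rank} S_0\le k$. Let $\mathcal C_{\mathbf a}(\mathcal F_0)$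 be the set of all sequences $\mathcal F=(\mathcal F_0,\mathcal G)$ of $n_0+k$ vectors, where $\mathcal G=(g_1,\dots,g_k)$ is a sequence in $\mathcal H$ with $\|g_i\|^2=\alpha_i$ for $1\le i\le k$. Suppose that $\mathcal F=(\mathcal F_0,\mathcal G)\in\mathcal C_{\mathbf a}(\mathcal F_0)$ is a global minimizer of $P_f$ on $\mathcal C_{\mathbf a}(\mathcal F_0)$, and let $z\in\sigma(S_{\mathcal G})\setminus\{0\}$. Then: 1. There exists $w\in\sigma(S_0)$ such that $\ker(S_{\mathcal G}-z)\subseteq\ker(S_0-w)$. 2. In particular, if $P$ is a sub-projection of the spectral projection $P(z)$ of $S_{\mathcal G}$ onto $\ker(S_{\mathcal G}-z)$, that is, an orthogonal projection with $P\le P(z)$, then $P$ and $S_0$ commute. -/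

import Mathlib

namespace FrameCompletion

open Module

variable {H : Type*} [NormedAddCommGroup H] [InnerProductSpace ℂ H]

/-- The frame operator `S_F = ∑ i, f_i ⊗ f_i` of a finite sequence `F = (f_i)` in `H`, where
`f ⊗ f` is the rank one operator `x ↦ ⟪f, x⟫ • f` (Mathlib's inner product is linear in its
second variable). -/
noncomputable def frameOperator {n : ℕ} (F : Fin n → H) : H →ₗ[ℂ] H :=
  ∑ i, (InnerProductSpace.rankOne ℂ (F i) (F i) : H →L[ℂ] H).toLinearMap

theorem frameOperator_apply {n : ℕ} (F : Fin n → H) (x : H) :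
    frameOperator F x = ∑ i, inner ℂ (F i) x • F i := by
  simp [frameOperator]

theorem frameOperator_isSymmetric {n : ℕ} (F : Fin n → H) : (frameOperator F).IsSymmetric := by
  intro x y
  simp only [frameOperator_apply, sum_inner, inner_sum, inner_smul_left, inner_smul_right,
    inner_conj_symm]
  exact Finset.sum_congr rfl fun i _ => mul_comm _ _

/-- `f : [0, ∞) → (-∞, ∞]` is strictly convex. Only the values of `f` on `[0, ∞)` matter. The
strict inequality forces `f` to be finite on `(0, ∞)`, so that the only possible infinite value
is `f 0 = ∞`; real-valued strictly convex functions on `[0, ∞)`, and `x ↦ x⁻¹` with `f 0 = ∞`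
(the mean square error), are included. -/
def StrictConvexOnNonneg (f : ℝ → EReal) : Prop :=
  (∀ x : ℝ, 0 ≤ x → f x ≠ ⊥) ∧
    ∀ x y : ℝ, 0 ≤ x → 0 ≤ y → x ≠ y → ∀ a b : ℝ, 0 < a → 0 < b → a + b = 1 →
      f (a * x + b * y) < (a : EReal) * f x + (b : EReal) * f y

/-- The convex potential `P_f(F) = tr f(S_F)`: the sum of the values of `f` at the eigenvalues of
the frame operator of `F`, counted with multiplicity. -/
noncomputable def convexPotential [FiniteDimensional ℂ H] (f : ℝ → EReal) {n : ℕ}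
    (F : Fin n → H) : EReal :=
  ∑ i : Fin (finrank ℂ H), f ((frameOperator_isSymmetric F).eigenvalues rfl i)

/-- The set of completions of `F₀` by `k` vectors with prescribed squared norms `a`:
sequences `F` of `n₀ + k` vectors whose first `n₀` vectors are those of `F₀`, and whose last `k`
vectors have squared norms `a 0, …, a (k - 1)`. -/
def completions {n₀ k : ℕ} (F₀ : Fin n₀ → H) (a : Fin k → ℝ) : Set (Fin (n₀ + k) → H) :=
  {F | (∀ i : Fin n₀, F (Fin.castAdd k i) = F₀ i) ∧
    ∀ i : Fin k, ‖F (Fin.natAdd n₀ i)‖ ^ 2 = a i}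

/-- `(F₀, a)` are initial data for the completion problem: the prescribed squared norms are
positive and `dim H - rank S_{F₀} ≤ k`. -/
def IsInitialData {n₀ k : ℕ} (F₀ : Fin n₀ → H) (a : Fin k → ℝ) : Prop :=
  (∀ i, 0 < a i) ∧ finrank ℂ H ≤ finrank ℂ (LinearMap.range (frameOperator F₀)) + k

/-- The spectral projection of `S` at `z`: the orthogonal projection onto `ker (S - z)`. -/
noncomputable def spectralProjection [FiniteDimensional ℂ H] (S : H →ₗ[ℂ] H) (z : ℂ) :
    H →ₗ[ℂ] H :=
  (LinearMap.ker (S - algebraMap ℂ (End ℂ H) z)).starProjection.toLinearMap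

/-- `P` is a sub-projection of `Q`: an orthogonal projection with `P ≤ Q` in the usual
(Loewner) order of operators. -/
def IsSubprojection [FiniteDimensional ℂ H] (P Q : H →ₗ[ℂ] H) : Prop :=
  P.IsSymmetricProjection ∧ P ≤ Q

end FrameCompletion

/-! ### Subgradients, eigenbases and Klein's inequality. -/

namespace FrameCompletion

open Module Set Filter Topology

/-! Write `A = S₀ + S_G` and first suppose that `A` is positive definite, so that only the values of
`f` on `(0, ∞)`, which are finite, enter. Two kinds of perturbation, each preserving all norms
`‖g_i‖`, are excluded by minimality. Both are tested with Klein's inequality, applied with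
subgradients at the eigenvalues of the perturbed operator; strict convexity enters only through
strict monotonicity of the subgradients.

Rotating one vector `g_i` towards the direction of steepest descent shows that it is an eigenvector
of `A` (`exists_apply_eq_smul_of_isMin`). Since `f` need not be differentiable, the first-order
condition is a limit of subgradient inequalities, and Chebyshev's sum inequality concludes.
Consequently `A` commutes with `S_G`, and each eigenspace of `S_G` is spanned by eigenvectors of
`A`.

If an eigenspace of `S_G` at `z ≠ 0` contained eigenvectors `u₁, u₂` of `A` with eigenvalues `c₁ <
c₂`, no `g_i` could have components along both. The vectors can then be moved, without changing
norms, so that `S_G` gains `ε (u₁ ⊗ u₁ - u₂ ⊗ u₂)`. This brings `c₁` and `c₂` closer and lowers the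
potential (`IsPotentialMin.not_lt`). Hence `A` is a scalar on the eigenspace, and so is `S₀ = A -
S_G`.

In general, `exists_forall_apply_eq_of_isMinOn` passes to the orthogonal complement of the kernel of
the full frame operator, where that operator is positive definite. The kernel contributes only a
constant multiple of `f 0`, finite because the rank condition provides a competitor of finite
potential. -/

/-- A strictly convex function on `(0, ∞)` has a strictly increasing selection of subgradients. -/
theorem exists_strictMonoOn_subgradient {φ : ℝ → ℝ} (hφ : StrictConvexOn ℝ (Ioi 0) φ) :
    ∃ g : ℝ → ℝ, StrictMonoOn g (Ioi 0) ∧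
      ∀ x, 0 < x → ∀ y, 0 < y → φ x + g x * (y - x) ≤ φ y := by
  have hint : ∀ {x : ℝ}, 0 < x → x ∈ interior (Ioi (0 : ℝ)) := fun hx => by
    rwa [interior_Ioi]
  have hlt : ∀ {x y : ℝ}, 0 < x → x < y →
      slope φ x y ≤ derivWithin φ (Ioi y) y := fun {x y} hx hxy =>
    (hφ.convexOn.slope_le_leftDeriv_of_mem_interior hx (hint (hx.trans hxy)) hxy).trans
      (hφ.convexOn.leftDeriv_le_rightDeriv_of_mem_interior (hint (hx.trans hxy)))
  -- The selection is the right derivative. Strictness: right derivative at `x` < slope from `x` to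
  -- `y` ≤ left derivative at `y` ≤ right derivative at `y`.
  refine ⟨fun x => derivWithin φ (Ioi x) x, fun x hx y hy hxy => ?_, fun x hx y hy => ?_⟩
  · exact (hφ.rightDeriv_lt_slope hx hy hxy
      (hφ.convexOn.differentiableWithinAt_Ioi_of_mem_interior (hint hx))).trans_le (hlt hx hxy)
  · rcases lt_trichotomy x y with hxy | rfl | hxy
    · have h := hφ.convexOn.rightDeriv_le_slope_of_mem_interior (hint hx) hy hxy
      rw [slope_def_field, le_div_iff₀ (by linarith)] at h
      linarith
    · simp
    · have h := hlt hy hxy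
      rw [slope_def_field, div_le_iff₀ (by linarith)] at h
      simp only
      linarith

variable {E : Type*} [NormedAddCommGroup E] [InnerProductSpace ℂ E] {ι κ : Type*} [Fintype ι]
  [Fintype κ]

/-- `b` is an orthonormal basis of eigenvectors of `T` with eigenvalues `c`. -/
def IsEigenbasis (T : E →ₗ[ℂ] E) (b : OrthonormalBasis ι ℂ E) (c : ι → ℝ) : Prop :=
  ∀ p, T (b p) = (c p : ℂ) • b p

theorem IsEigenbasis.inner_apply {T : E →ₗ[ℂ] E} {b : OrthonormalBasis ι ℂ E} {c : ι → ℝ}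
    (h : IsEigenbasis T b c) (x y : E) :
    inner ℂ x (T y) = ∑ p, (c p : ℂ) * (inner ℂ x (b p) * inner ℂ (b p) y) := by
  conv_lhs => rw [← b.sum_repr' y]
  simp only [map_sum, map_smul, h _, inner_sum, inner_smul_right]
  exact Finset.sum_congr rfl fun p _ => by ring

theorem IsEigenbasis.re_inner_apply_self {T : E →ₗ[ℂ] E} {b : OrthonormalBasis ι ℂ E} {c : ι → ℝ}
    (h : IsEigenbasis T b c) (x : E) :
    (inner ℂ x (T x)).re = ∑ p, c p * ‖inner ℂ (b p) x‖ ^ 2 := by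
  rw [h.inner_apply, Complex.re_sum]
  refine Finset.sum_congr rfl fun p _ => ?_
  rw [← inner_conj_symm x, Complex.conj_mul', Complex.re_ofReal_mul]
  norm_cast

/-- Eigenvectors of an operator at different eigenvalues are orthogonal. -/
theorem IsEigenbasis.eq_of_inner_ne_zero {T : E →ₗ[ℂ] E} {b : OrthonormalBasis ι ℂ E} {c : ι → ℝ}
    (h : IsEigenbasis T b c) (hT : T.IsSymmetric) {r : ℝ} {x : E} (hx : T x = (r : ℂ) • x) {p : ι}
    (hp : inner ℂ (b p) x ≠ 0) : c p = r := by
  have := hT (b p) x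
  rw [h p, hx, inner_smul_left, inner_smul_right, Complex.conj_ofReal] at this
  exact_mod_cast mul_right_cancel₀ hp this

theorem IsEigenbasis.eigenvalue_eq {T : E →ₗ[ℂ] E} {b : OrthonormalBasis ι ℂ E} {c : ι → ℝ}
    (h : IsEigenbasis T b c) (p : ι) : c p = (inner ℂ (b p) (T (b p))).re := by
  rw [h p, inner_smul_right, inner_self_eq_norm_sq_to_K]
  simp

/-- Klein's inequality for a convex function with subgradients `g`. -/
theorem klein_inequality {φ g : ℝ → ℝ}
    (hg : ∀ x, 0 < x → ∀ y, 0 < y → φ x + g x * (y - x) ≤ φ y)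
    {A B : E →ₗ[ℂ] E} {e : OrthonormalBasis ι ℂ E} {a : ι → ℝ} {v : OrthonormalBasis κ ℂ E}
    {c : κ → ℝ} (hA : IsEigenbasis A e a) (hB : IsEigenbasis B v c) (ha : ∀ q, 0 < a q)
    (hc : ∀ p, 0 < c p) :
    ∑ p, φ (c p) + ∑ p, g (c p) * (inner ℂ (v p) ((A - B) (v p))).re ≤ ∑ q, φ (a q) := by
  -- The squared moduli of the change-of-basis matrix are doubly stochastic; the subgradient
  -- inequalities are averaged with these weights.
  have hv : ∀ p, ∑ q, ‖inner ℂ (e q) (v p)‖ ^ 2 = 1 := fun p => by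
    rw [e.sum_sq_norm_inner_right, v.norm_eq_one, one_pow]
  have he : ∀ q, ∑ p, ‖inner ℂ (e q) (v p)‖ ^ 2 = 1 := fun q => by
    rw [v.sum_sq_norm_inner_left, e.norm_eq_one, one_pow]
  have key : ∀ p, φ (c p) + g (c p) * (inner ℂ (v p) ((A - B) (v p))).re ≤
      ∑ q, ‖inner ℂ (e q) (v p)‖ ^ 2 * φ (a q) := fun p => by
    have h1 : φ (c p) + g (c p) * (inner ℂ (v p) ((A - B) (v p))).re =
        ∑ q, ‖inner ℂ (e q) (v p)‖ ^ 2 * (φ (c p) + g (c p) * (a q - c p)) := by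
      rw [LinearMap.sub_apply, inner_sub_right, Complex.sub_re, ← hB.eigenvalue_eq,
        hA.re_inner_apply_self]
      have : ∀ q, ‖inner ℂ (e q) (v p)‖ ^ 2 * (φ (c p) + g (c p) * (a q - c p)) =
        (φ (c p) - g (c p) * c p) * ‖inner ℂ (e q) (v p)‖ ^ 2 +
          g (c p) * (a q * ‖inner ℂ (e q) (v p)‖ ^ 2) := fun q => by ring
      simp only [this, Finset.sum_add_distrib, ← Finset.mul_sum, hv]
      ring
    rw [h1]
    exact Finset.sum_le_sum fun q _ =>
      mul_le_mul_of_nonneg_left (hg _ (hc p) _ (ha q)) (by positivity)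
  rw [← Finset.sum_add_distrib]
  refine (Finset.sum_le_sum fun p _ => key p).trans_eq ?_
  rw [Finset.sum_comm]
  exact Finset.sum_congr rfl fun q _ => by rw [← Finset.sum_mul, he, one_mul]

section FiniteDimensional

variable [FiniteDimensional ℂ E]

/-- The characteristic polynomial does not depend on the basis, so this allows eigenvalue lists over
different bases and index types to be compared. -/
theorem IsEigenbasis.roots_charpoly {T : E →ₗ[ℂ] E} {b : OrthonormalBasis ι ℂ E} {c : ι → ℝ}
    (h : IsEigenbasis T b c) : T.charpoly.roots = Finset.univ.val.map fun p => (c p : ℂ) := by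
  classical
  have hM : LinearMap.toMatrix b.toBasis b.toBasis T = Matrix.diagonal fun p => (c p : ℂ) := by
    ext i j
    rw [LinearMap.toMatrix_apply, b.coe_toBasis, h j, map_smul, ← b.coe_toBasis,
      Basis.repr_self, Matrix.diagonal_apply]
    by_cases hij : i = j
    · simp [hij]
    · simp [hij]
  rw [← LinearMap.charpoly_toMatrix T b.toBasis, hM, Matrix.charpoly_diagonal,
    Polynomial.roots_prod _ _ (by simp [Finset.prod_ne_zero_iff, Polynomial.X_sub_C_ne_zero])]
  simp

/-- The eigenvalues along two eigenbases agree up to a permutation. -/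
theorem IsEigenbasis.sum_eq {M : Type*} [AddCommMonoid M] {T : E →ₗ[ℂ] E}
    {b : OrthonormalBasis ι ℂ E} {c : ι → ℝ} {b' : OrthonormalBasis κ ℂ E} {c' : κ → ℝ}
    (h : IsEigenbasis T b c) (h' : IsEigenbasis T b' c') (f : ℝ → M) :
    ∑ p, f (c p) = ∑ p, f (c' p) := by
  have := congrArg (fun s => (s.map fun w : ℂ => f w.re).sum)
    (h.roots_charpoly.symm.trans h'.roots_charpoly)
  simpa [Multiset.map_map] using this

theorem isEigenbasis_eigenvectorBasis {T : E →ₗ[ℂ] E} (hT : T.IsSymmetric) :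
    IsEigenbasis T (hT.eigenvectorBasis rfl) (hT.eigenvalues rfl) :=
  fun p => hT.apply_eigenvectorBasis rfl p

end FiniteDimensional
end FrameCompletion

/-! ### First-order optimality when one vector is exchanged. -/

namespace FrameCompletion

open Module Set Filter Topology

variable {E : Type*} [NormedAddCommGroup E] [InnerProductSpace ℂ E] {ι : Type*} [Fintype ι]

/-- The operator obtained from `A` by exchanging the summand `h ⊗ h` for `y ⊗ y`. -/
noncomputable def exchange (A : E →ₗ[ℂ] E) (h y : E) : E →ₗ[ℂ] E :=
  A - (InnerProductSpace.rankOne ℂ h h : E →L[ℂ] E).toLinearMap +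
    (InnerProductSpace.rankOne ℂ y y : E →L[ℂ] E).toLinearMap

theorem exchange_apply (A : E →ₗ[ℂ] E) (h y x : E) :
    exchange A h y x = A x - inner ℂ h x • h + inner ℂ y x • y := by
  simp [exchange]

theorem exchange_isSymmetric {A : E →ₗ[ℂ] E} (hA : A.IsSymmetric) (h y : E) :
    (exchange A h y).IsSymmetric := by
  intro u v
  simp only [exchange_apply, inner_add_left, inner_sub_left, inner_add_right, inner_sub_right,
    inner_smul_left, inner_smul_right, inner_conj_symm, hA u v]
  ring

theorem re_inner_sub_exchange (A : E →ₗ[ℂ] E) (h y x : E) :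
    (inner ℂ x ((A - exchange A h y) x)).re = ‖inner ℂ x h‖ ^ 2 - ‖inner ℂ x y‖ ^ 2 := by
  rw [LinearMap.sub_apply, exchange_apply]
  simp only [inner_sub_right, inner_add_right, inner_smul_right]
  rw [← inner_conj_symm x h, ← inner_conj_symm x y, Complex.mul_conj', Complex.mul_conj']
  simp only [RCLike.norm_conj]
  simp only [← Complex.ofReal_pow, Complex.sub_re, Complex.add_re, Complex.ofReal_re]
  ring

/-- The factor `u - v` isolates the increment of the curve, so that dividing by `t` produces a
difference quotient with a limit. -/
theorem norm_sq_sub_norm_sq_eq (u v : ℂ) :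
    ‖u‖ ^ 2 - ‖v‖ ^ 2 = ((u - v) * (starRingEnd ℂ) (u + v)).re := by
  rw [← Complex.normSq_eq_norm_sq, ← Complex.normSq_eq_norm_sq]
  simp [Complex.normSq_apply]
  ring

/-- Chebyshev's sum inequality: if `ζ` increases strictly with `a`, then the covariance of `a` and
`ζ` for the weights `w` is positive unless `a` is constant on the support of `w`. -/
theorem eq_of_sum_mul_nonpos {w a ζ : ι → ℝ} (hw : ∀ p, 0 ≤ w p)
    (hζ : ∀ p q, a p < a q → ζ p < ζ q) {ρ : ℝ} (hρ : ∑ p, w p * (a p - ρ) = 0)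
    (h : ∑ p, ζ p * (w p * (a p - ρ)) ≤ 0) {p q : ι} (hp : 0 < w p) (hq : 0 < w q) :
    a p = a q := by
  -- Symmetrization turns the covariance into a sum of nonnegative terms; if it is nonpositive,
  -- every term vanishes.
  have hdouble : ∑ p, ∑ q, w p * w q * ((ζ p - ζ q) * (a p - a q)) =
      2 * (∑ p, w p) * ∑ p, ζ p * (w p * (a p - ρ)) := by
    have : ∀ p q, w p * w q * ((ζ p - ζ q) * (a p - a q)) =
        (ζ p * (w p * (a p - ρ))) * w q - (w p * ζ p) * (w q * (a q - ρ))
        - (w p * (a p - ρ)) * (w q * ζ q) + w p * (ζ q * (w q * (a q - ρ))) := fun p q => by ring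
    simp only [this, Finset.sum_add_distrib, Finset.sum_sub_distrib, ← Finset.mul_sum,
      ← Finset.sum_mul, hρ]
    ring
  have hnonneg : ∀ p q, 0 ≤ w p * w q * ((ζ p - ζ q) * (a p - a q)) := fun p q => by
    refine mul_nonneg (mul_nonneg (hw p) (hw q)) ?_
    rcases lt_trichotomy (a p) (a q) with h | h | h
    · exact (mul_pos_of_neg_of_neg (sub_neg.2 (hζ _ _ h)) (sub_neg.2 h)).le
    · simp [h]
    · exact (mul_pos (sub_pos.2 (hζ _ _ h)) (sub_pos.2 h)).le
  have hzero : ∑ p, ∑ q, w p * w q * ((ζ p - ζ q) * (a p - a q)) = 0 := by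
    refine le_antisymm ?_ (Finset.sum_nonneg fun p _ => Finset.sum_nonneg fun q _ => hnonneg p q)
    rw [hdouble]
    exact mul_nonpos_of_nonneg_of_nonpos
      (mul_nonneg zero_le_two (Finset.sum_nonneg fun p _ => hw p)) h
  have h1 := (Finset.sum_eq_zero_iff_of_nonneg fun p _ =>
    Finset.sum_nonneg fun q _ => hnonneg p q).1 hzero p (Finset.mem_univ _)
  have h2 := (Finset.sum_eq_zero_iff_of_nonneg fun q _ => hnonneg p q).1 h1 q (Finset.mem_univ _)
  have h3 : (ζ p - ζ q) * (a p - a q) = 0 :=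
    (mul_eq_zero.1 h2).resolve_left (mul_pos hp hq).ne'
  rcases lt_trichotomy (a p) (a q) with h | h | h
  · exact absurd h3 (mul_pos_of_neg_of_neg (sub_neg.2 (hζ _ _ h)) (sub_neg.2 h)).ne'
  · exact h
  · exact absurd h3 (mul_pos (sub_pos.2 (hζ _ _ h)) (sub_pos.2 h)).ne'

/-- A bounded family of vectors in a proper space converges along an ultrafilter. -/
theorem exists_tendsto_ultrafilter {X α : Type*} [PseudoMetricSpace X] [ProperSpace X]
    (U : Ultrafilter α) {u : α → X} {x : X} {r : ℝ} (h : ∀ᶠ t in U, dist (u t) x ≤ r) :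
    ∃ y, Tendsto u U (𝓝 y) := by
  obtain ⟨y, -, hy⟩ := (isCompact_closedBall x r).ultrafilter_le_nhds (U.map u)
    (by rw [Filter.le_principal_iff]; exact h)
  exact ⟨y, hy⟩

variable [FiniteDimensional ℂ E]

/-- First-order optimality: if `A` minimizes `tr φ` among the operators `A - h ⊗ h + y ⊗ y` with
`‖y‖ = ‖h‖`, then `h` is an eigenvector of `A`. -/
theorem exists_apply_eq_smul_of_isMin {φ : ℝ → ℝ} (hφ : StrictConvexOn ℝ (Ioi 0) φ)
    {A : E →ₗ[ℂ] E} (hA : A.IsSymmetric) {e : OrthonormalBasis (Fin (finrank ℂ E)) ℂ E}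
    {a : Fin (finrank ℂ E) → ℝ} (he : IsEigenbasis A e a) (ha : ∀ p, 0 < a p) (h : E)
    (hmin : ∀ y : E, ‖y‖ = ‖h‖ → ∀ (b : OrthonormalBasis (Fin (finrank ℂ E)) ℂ E)
      (c : Fin (finrank ℂ E) → ℝ), IsEigenbasis (exchange A h y) b c → (∀ p, 0 < c p) →
        ∑ p, φ (a p) ≤ ∑ p, φ (c p)) :
    ∃ r : ℝ, A h = (r : ℂ) • h := by
  obtain ⟨g, hgmono, hg⟩ := exists_strictMonoOn_subgradient hφ
  by_cases h0 : h = 0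
  · exact ⟨0, by simp [h0]⟩
  have hn : 0 < ‖h‖ := norm_pos_iff.2 h0
  -- the direction of steepest descent, rescaled to the norm of `h`
  set ρ : ℝ := (inner ℂ h (A h)).re / ‖h‖ ^ 2 with hρ
  by_contra! hne
  set y₀ : E := (ρ : ℂ) • h - A h with hy₀
  have hy0 : 0 < ‖y₀‖ := norm_pos_iff.2 (sub_ne_zero.2 (hne ρ).symm)
  have him : ((inner ℂ h (A h)).re : ℂ) = inner ℂ h (A h) := by
    have := hA.coe_re_inner_self_apply h
    simpa using this
  have horth₀ : inner ℂ h y₀ = 0 := by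
    rw [hy₀, inner_sub_right, inner_smul_right, inner_self_eq_norm_sq_to_K, hρ]
    push_cast
    rw [him]
    have : (‖h‖ : ℂ) ≠ 0 := by exact_mod_cast hn.ne'
    simp only [Complex.coe_algebraMap]
    field_simp
    simp
  set s : ℝ := ‖h‖ / ‖y₀‖ with hs
  have hspos : 0 < s := div_pos hn hy0
  set y : E := (s : ℂ) • y₀ with hy
  have hynorm : ‖y‖ = ‖h‖ := by
    rw [hy, norm_smul, Complex.norm_real, Real.norm_of_nonneg hspos.le, hs]
    field_simp
  have horth : inner ℂ h y = 0 := by rw [hy, inner_smul_right, horth₀, mul_zero]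
  -- A great circle on the sphere of radius `‖h‖`, leaving `h` with velocity `y`.
  set γ : ℝ → E := fun t => (Real.cos t : ℂ) • h + (Real.sin t : ℂ) • y with hγ
  have hγnorm : ∀ t, ‖γ t‖ = ‖h‖ := fun t => by
    have h1 : ‖γ t‖ ^ 2 = ‖h‖ ^ 2 := by
      have := norm_add_sq_eq_norm_sq_add_norm_sq_of_inner_eq_zero (𝕜 := ℂ)
        ((Real.cos t : ℂ) • h) ((Real.sin t : ℂ) • y)
        (by rw [inner_smul_left, inner_smul_right, horth]; simp)
      rw [hγ, pow_two, this, norm_smul, norm_smul, hynorm, Complex.norm_real, Complex.norm_real,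
        Real.norm_eq_abs, Real.norm_eq_abs]
      linear_combination ‖h‖ ^ 2 * (Real.sin_sq_add_cos_sq t) + ‖h‖ ^ 2 * sq_abs (Real.cos t)
        + ‖h‖ ^ 2 * sq_abs (Real.sin t)
    exact (sq_eq_sq₀ (norm_nonneg _) (norm_nonneg _)).1 h1
  have hγ0 : γ 0 = h := by simp [hγ]
  have hγderiv : HasDerivAt γ y 0 := by
    have h1 : HasDerivAt (fun t : ℝ => (Real.cos t : ℂ)) ((-Real.sin 0 : ℝ) : ℂ) 0 :=
      (Real.hasDerivAt_cos 0).ofReal_comp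
    have h2 : HasDerivAt (fun t : ℝ => (Real.sin t : ℂ)) ((Real.cos 0 : ℝ) : ℂ) 0 :=
      (Real.hasDerivAt_sin 0).ofReal_comp
    have h3 := (h1.smul_const h).add (h2.smul_const y)
    simp only [Real.sin_zero, Real.cos_zero, neg_zero, Complex.ofReal_zero, zero_smul, zero_add,
      Complex.ofReal_one, one_smul] at h3
    exact h3
  have hγcont : Tendsto γ (𝓝[>] 0) (𝓝 h) := by
    have := hγderiv.continuousAt.tendsto
    rw [hγ0] at this
    exact this.mono_left nhdsWithin_le_nhds
  -- eigenbases of the perturbed operators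
  have hsym : ∀ t, (exchange A h (γ t)).IsSymmetric := fun t => exchange_isSymmetric hA h _
  set v : ℝ → Fin (finrank ℂ E) → E := fun t p => (hsym t).eigenvectorBasis rfl p with hv
  set c : ℝ → Fin (finrank ℂ E) → ℝ := fun t p => (hsym t).eigenvalues rfl p with hc
  have heig : ∀ t, IsEigenbasis (exchange A h (γ t)) ((hsym t).eigenvectorBasis rfl) (c t) :=
    fun t => isEigenbasis_eigenvectorBasis (hsym t)
  -- The eigenbases need not depend continuously on `t`. Along an ultrafilter finer than `𝓝[>] 0`
  -- every bounded choice converges, so eigenvectors, eigenvalues and subgradients all have limits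
  -- without extracting subsequences.
  let U : Ultrafilter ℝ := Ultrafilter.of (𝓝[>] 0)
  have hU : (U : Filter ℝ) ≤ 𝓝[>] 0 := Ultrafilter.of_le _
  have hvnorm : ∀ t p, ‖v t p‖ = 1 := fun t p => OrthonormalBasis.norm_eq_one _ _
  have hlim : ∀ p, ∃ x, Tendsto (fun t => v t p) U (𝓝 x) := fun p =>
    exists_tendsto_ultrafilter U (x := 0) (r := 1)
      (Eventually.of_forall fun t => by simp [hvnorm])
  choose u hu using hlim
  have huorth : Orthonormal ℂ u := by
    rw [orthonormal_iff_ite]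
    intro i j
    have h1 : Tendsto (fun t => inner ℂ (v t i) (v t j)) U (𝓝 (inner ℂ (u i) (u j))) :=
      (hu i).inner (hu j)
    refine tendsto_nhds_unique h1 (tendsto_const_nhds.congr fun t => ?_)
    exact (orthonormal_iff_ite.1 ((hsym t).eigenvectorBasis rfl).orthonormal i j).symm
  obtain ⟨b, hb⟩ := Orthonormal.exists_orthonormalBasis_extension_of_card_eq (𝕜 := ℂ) (v := u)
    (s := univ) (by simp) (huorth.comp _ Subtype.val_injective)
  replace hb : ∀ p, b p = u p := fun p => hb p (mem_univ p)
  have hγU : Tendsto γ U (𝓝 h) := hγcont.mono_left hU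
  have hAv : ∀ p, Tendsto (fun t => exchange A h (γ t) (v t p)) U (𝓝 (A (u p))) := fun p => by
    have h1 : Tendsto (fun t => A (v t p)) U (𝓝 (A (u p))) :=
      (A.continuous_of_finiteDimensional.tendsto _).comp (hu p)
    have h2 : Tendsto (fun t => inner ℂ h (v t p) • h) U (𝓝 (inner ℂ h (u p) • h)) :=
      (tendsto_const_nhds.inner (hu p)).smul_const h
    have h3 : Tendsto (fun t => inner ℂ (γ t) (v t p) • γ t) U (𝓝 (inner ℂ h (u p) • h)) :=
      (hγU.inner (hu p)).smul hγU
    simpa [exchange_apply] using (h1.sub h2).add h3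
  set a' : Fin (finrank ℂ E) → ℝ := fun p => (inner ℂ (u p) (A (u p))).re with ha'
  have hca : ∀ p, Tendsto (fun t => c t p) U (𝓝 (a' p)) := fun p => by
    have h1 : Tendsto (fun t => (inner ℂ (v t p) (exchange A h (γ t) (v t p))).re) U (𝓝 (a' p)) :=
      (Complex.continuous_re.tendsto _).comp ((hu p).inner (hAv p))
    exact h1.congr fun t => ((heig t).eigenvalue_eq p).symm
  have hb' : IsEigenbasis A b a' := fun p => by
    rw [hb]
    refine tendsto_nhds_unique (hAv p) ?_
    have h1 : Tendsto (fun t => (c t p : ℂ) • v t p) U (𝓝 ((a' p : ℂ) • u p)) :=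
      ((Complex.continuous_ofReal.tendsto _).comp (hca p)).smul (hu p)
    exact h1.congr fun t => (heig t p).symm
  have ha'pos : ∀ p, 0 < a' p := fun p => by
    rw [ha']
    simp only
    rw [he.re_inner_apply_self]
    have h1 : ∑ q, ‖inner ℂ (e q) (u p)‖ ^ 2 = 1 := by
      rw [e.sum_sq_norm_inner_right, huorth.1 p, one_pow]
    obtain ⟨q, -, hq⟩ := Finset.exists_ne_zero_of_sum_ne_zero (h1.trans_ne one_ne_zero)
    exact Finset.sum_pos' (fun q _ => mul_nonneg (ha q).le (sq_nonneg _))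
      ⟨q, Finset.mem_univ q, mul_pos (ha q) (lt_of_le_of_ne (sq_nonneg _) hq.symm)⟩
  have hcpos : ∀ᶠ t in (U : Filter ℝ), ∀ p, 0 < c t p :=
    eventually_all.2 fun p => (hca p).eventually (lt_mem_nhds (ha'pos p))
  have hζ : ∀ p, ∃ ζ, Tendsto (fun t => g (c t p)) U (𝓝 ζ) := fun p => by
    have h1 : ∀ᶠ t in (U : Filter ℝ), a' p / 2 < c t p :=
      (hca p).eventually (lt_mem_nhds (by linarith [ha'pos p]))
    have h2 : ∀ᶠ t in (U : Filter ℝ), c t p < 2 * a' p :=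
      (hca p).eventually (gt_mem_nhds (by linarith [ha'pos p]))
    have h3 : ∀ᶠ t in (U : Filter ℝ), g (c t p) ∈ Icc (g (a' p / 2)) (g (2 * a' p)) := by
      filter_upwards [h1, h2] with t ht1 ht2
      have hp := ha'pos p
      have h0 : 0 < c t p := by linarith
      exact ⟨hgmono.monotoneOn (by simp [hp]) h0 ht1.le,
        hgmono.monotoneOn h0 (by simp [hp]) ht2.le⟩
    obtain ⟨ζ, -, h4⟩ := isCompact_Icc.ultrafilter_le_nhds (U.map fun t => g (c t p))
      (by rw [Filter.le_principal_iff]; exact h3)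
    exact ⟨ζ, h4⟩
  choose ζ hζ using hζ
  -- `ζ p` need not equal `g (a' p)`, since `g` may jump. Two intermediate points keep the
  -- inequality strict in the limit.
  have hζmono : ∀ p q, a' p < a' q → ζ p < ζ q := fun p q hpq => by
    obtain ⟨m₁, hm1, hm1q⟩ := exists_between hpq
    obtain ⟨m₂, hm12, hm2⟩ := exists_between hm1q
    have hm1pos : 0 < m₁ := (ha'pos p).trans hm1
    have h1 : ζ p ≤ g m₁ := le_of_tendsto (hζ p) (by
      filter_upwards [hcpos, (hca p).eventually (gt_mem_nhds hm1)] with t ht ht'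
      exact hgmono.monotoneOn (ht p) hm1pos ht'.le)
    have h2 : g m₂ ≤ ζ q := ge_of_tendsto (hζ q) (by
      filter_upwards [hcpos, (hca q).eventually (lt_mem_nhds hm2)] with t ht ht'
      exact hgmono.monotoneOn (hm1pos.trans hm12) (ht q) ht'.le)
    exact h1.trans_lt ((hgmono hm1pos (hm1pos.trans hm12) hm12).trans_le h2)
  -- the first-order condition
  have hineq : ∀ᶠ t in (U : Filter ℝ), ∑ p, g (c t p) *
      (inner ℂ (v t p) (t⁻¹ • (h - γ t)) * (starRingEnd ℂ) (inner ℂ (v t p) (h + γ t))).re ≤ 0 := by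
    filter_upwards [hcpos, hU self_mem_nhdsWithin] with t ht htpos
    have h1 := klein_inequality hg he (heig t) ha ht
    have h2 := hmin (γ t) (hγnorm t) _ _ (heig t) ht
    simp only [re_inner_sub_exchange, norm_sq_sub_norm_sq_eq, ← inner_sub_right,
      ← inner_add_right] at h1
    have h3 : ∀ p, (inner ℂ (v t p) (t⁻¹ • (h - γ t)) *
        (starRingEnd ℂ) (inner ℂ (v t p) (h + γ t))).re = t⁻¹ * (inner ℂ (v t p) (h - γ t) *
        (starRingEnd ℂ) (inner ℂ (v t p) (h + γ t))).re := fun p => by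
      rw [← Complex.coe_smul, inner_smul_right, mul_assoc, Complex.re_ofReal_mul]
    simp only [h3, mul_left_comm _ t⁻¹, ← Finset.mul_sum]
    exact mul_nonpos_of_nonneg_of_nonpos (inv_nonneg.2 (le_of_lt htpos)) (by linarith)
  have hslope : Tendsto (fun t : ℝ => t⁻¹ • (h - γ t)) U (𝓝 (-y)) := by
    have h1 := hγderiv.tendsto_slope_zero_right
    simp only [zero_add, hγ0] at h1
    refine ((h1.mono_left hU).neg).congr fun t => ?_
    rw [← smul_neg, neg_sub]
  have hlimineq : ∑ p, ζ p *
      (inner ℂ (u p) (-y) * (starRingEnd ℂ) (inner ℂ (u p) (h + h))).re ≤ 0 := by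
    refine le_of_tendsto (tendsto_finsetSum _ fun p _ => (hζ p).mul ?_) hineq
    exact (Complex.continuous_re.tendsto _).comp (((hu p).inner hslope).mul
      ((Complex.continuous_conj.tendsto _).comp ((hu p).inner (tendsto_const_nhds.add hγU))))
  set w : Fin (finrank ℂ E) → ℝ := fun p => ‖inner ℂ (b p) h‖ ^ 2 with hw
  have hwsum : ∑ p, w p = ‖h‖ ^ 2 := b.sum_sq_norm_inner_right h
  -- With `y` proportional to `ρ h - A h`, the limiting condition becomes the covariance of `a'` and
  -- `ζ` for the weights `w`; `ρ` is the mean of `a'`, being the Rayleigh quotient of `h`.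
  have hterm : ∀ p, (inner ℂ (u p) (-y) * (starRingEnd ℂ) (inner ℂ (u p) (h + h))).re =
      2 * s * (w p * (a' p - ρ)) := fun p => by
    have h1 : inner ℂ (b p) (A h) = (a' p : ℂ) * inner ℂ (b p) h := by
      rw [← hA, hb' p, inner_smul_left, Complex.conj_ofReal]
    rw [← hb, hw, hy, hy₀, inner_neg_right, inner_smul_right, inner_sub_right, inner_smul_right, h1,
      ← two_smul ℂ h, inner_smul_right, map_mul]
    have h2 : -((s : ℂ) * (ρ * inner ℂ (b p) h - a' p * inner ℂ (b p) h)) *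
        ((starRingEnd ℂ) 2 * (starRingEnd ℂ) (inner ℂ (b p) h)) =
        ((2 * s * (a' p - ρ) : ℝ) : ℂ) *
          (inner ℂ (b p) h * (starRingEnd ℂ) (inner ℂ (b p) h)) := by
      rw [map_ofNat]
      push_cast
      ring
    rw [h2, Complex.mul_conj', Complex.re_ofReal_mul, ← Complex.ofReal_pow, Complex.ofReal_re]
    ring
  have hcov : ∑ p, ζ p * (w p * (a' p - ρ)) ≤ 0 := by
    simp only [hterm, mul_left_comm _ (2 * s), ← Finset.mul_sum] at hlimineq
    exact nonpos_of_mul_nonpos_right hlimineq (by positivity)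
  have hρsum : ∑ p, w p * (a' p - ρ) = 0 := by
    have h1 := hb'.re_inner_apply_self h
    have h2 : ∀ p, w p * (a' p - ρ) = a' p * ‖inner ℂ (b p) h‖ ^ 2 - w p * ρ := fun p => by
      rw [hw]; ring
    simp only [h2, Finset.sum_sub_distrib, ← Finset.sum_mul, hwsum]
    rw [← h1, hρ]
    field_simp
    simp
  obtain ⟨p, -, hp⟩ := Finset.exists_ne_zero_of_sum_ne_zero
    (hwsum.trans_ne (pow_pos hn 2).ne')
  refine hne (a' p) ?_
  conv_lhs => rw [← b.sum_repr' h]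
  conv_rhs => rw [← b.sum_repr' h]
  rw [map_sum, Finset.smul_sum]
  refine Finset.sum_congr rfl fun q _ => ?_
  by_cases hq : inner ℂ (b q) h = 0
  · simp [hq]
  · have hwq : 0 < w q := pow_pos (norm_pos_iff.2 hq) 2
    rw [map_smul, hb' q, eq_of_sum_mul_nonpos (fun p => sq_nonneg _) hζmono hρsum hcov
      (lt_of_le_of_ne (sq_nonneg _) hp.symm) hwq, smul_comm]
end FrameCompletion

/-! ### Minimizers with positive definite total operator. -/

namespace FrameCompletion

open Module Set Filter Topology

variable {E : Type*} [NormedAddCommGroup E] [InnerProductSpace ℂ E]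

theorem frameOperator_update {k : ℕ} (G : Fin k → E) (i : Fin k) (y x : E) :
    frameOperator (Function.update G i y) x =
      frameOperator G x - inner ℂ (G i) x • G i + inner ℂ y x • y := by
  simp only [frameOperator_apply]
  rw [← Finset.add_sum_erase _ _ (Finset.mem_univ i),
    ← Finset.add_sum_erase (f := fun j => inner ℂ (G j) x • G j) _ (Finset.mem_univ i),
    Function.update_self]
  have : ∑ j ∈ Finset.univ.erase i, inner ℂ (Function.update G i y j) x • Function.update G i y j =
      ∑ j ∈ Finset.univ.erase i, inner ℂ (G j) x • G j :=
    Finset.sum_congr rfl fun j hj => by rw [Function.update_of_ne (Finset.ne_of_mem_erase hj)]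
  rw [this]
  abel

theorem inner_frameOperator_self {k : ℕ} (G : Fin k → E) (x : E) :
    inner ℂ x (frameOperator G x) = ((∑ i, ‖inner ℂ (G i) x‖ ^ 2 : ℝ) : ℂ) := by
  rw [frameOperator_apply, inner_sum, Complex.ofReal_sum]
  refine Finset.sum_congr rfl fun i _ => ?_
  rw [inner_smul_right, ← inner_conj_symm x, Complex.mul_conj']
  norm_cast

theorem eq_zero_of_frameOperator_eq_zero {k : ℕ} {G : Fin k → E} {x : E}
    (h : frameOperator G x = 0) (i : Fin k) : inner ℂ (G i) x = 0 := by
  have h1 := inner_frameOperator_self G x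
  rw [h, inner_zero_right, eq_comm, Complex.ofReal_eq_zero,
    Finset.sum_eq_zero_iff_of_nonneg fun i _ => sq_nonneg _] at h1
  simpa using h1 i (Finset.mem_univ i)

/-- The rank one perturbation of the identity which takes `u₁` to `v₁` and `u₂` to `v₂`. -/
noncomputable def replaceVectors (u₁ u₂ v₁ v₂ x : E) : E :=
  x + inner ℂ u₁ x • (v₁ - u₁) + inner ℂ u₂ x • (v₂ - u₂)

/-- The hypothesis on `x` says that its part orthogonal to `u` is also orthogonal to `v`. Replacing
the component along `u` by an equal multiple of `v` then preserves the norm by Pythagoras. -/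
theorem norm_add_inner_smul_sub {u v x : E} (hu : ‖u‖ = 1) (hv : ‖v‖ = 1)
    (hx : inner ℂ v x = inner ℂ v u * inner ℂ u x) :
    ‖x + inner ℂ u x • (v - u)‖ = ‖x‖ := by
  have hsplit : ∀ w : E, ‖w‖ = 1 → inner ℂ w (x - inner ℂ u x • u) = 0 →
      ‖(x - inner ℂ u x • u) + inner ℂ u x • w‖ ^ 2 =
        ‖x - inner ℂ u x • u‖ ^ 2 + ‖inner ℂ u x‖ ^ 2 := fun w hw h => by
    have := norm_add_sq_eq_norm_sq_add_norm_sq_of_inner_eq_zero (𝕜 := ℂ)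
      (x - inner ℂ u x • u) (inner ℂ u x • w)
      (by rw [inner_smul_right, inner_eq_zero_symm.1 h, mul_zero])
    rw [pow_two, this, norm_smul, hw]
    ring
  have h1 := hsplit v hv (by rw [inner_sub_right, inner_smul_right, hx]; ring)
  have h2 := hsplit u hu (by
    rw [inner_sub_right, inner_smul_right, inner_self_eq_norm_sq_to_K, hu]; simp)
  rw [sub_add_cancel] at h2
  have h3 : x + inner ℂ u x • (v - u) = (x - inner ℂ u x • u) + inner ℂ u x • v := by
    rw [smul_sub]; abel
  rw [h3]
  exact (sq_eq_sq₀ (norm_nonneg _) (norm_nonneg _)).1 (h1.trans h2.symm)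

/-- Applying a linear map `R` to the vectors turns `S_G` into `R S_G R*`. Here `R` sends `u_i` to
`v_i` and fixes their orthogonal complement, while `S_G` is `z` on the span of `u₁, u₂`; only the
part `z (u₁ ⊗ u₁ + u₂ ⊗ u₂)` changes. -/
theorem frameOperator_replaceVectors {k : ℕ} (G : Fin k → E) {u₁ u₂ : E} (hu₁ : ‖u₁‖ = 1)
    (hu₂ : ‖u₂‖ = 1) (h12 : inner ℂ u₁ u₂ = 0) {z : ℝ} (hz₁ : frameOperator G u₁ = (z : ℂ) • u₁)
    (hz₂ : frameOperator G u₂ = (z : ℂ) • u₂) (v₁ v₂ x : E) :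
    frameOperator (fun i => replaceVectors u₁ u₂ v₁ v₂ (G i)) x = frameOperator G x +
      (z : ℂ) • (inner ℂ v₁ x • v₁ - inner ℂ u₁ x • u₁ + (inner ℂ v₂ x • v₂ - inner ℂ u₂ x • u₂)) := by
  have h21 : inner ℂ u₂ u₁ = 0 := inner_eq_zero_symm.1 h12
  have h11 : inner ℂ u₁ u₁ = (1 : ℂ) := by rw [inner_self_eq_norm_sq_to_K, hu₁]; simp
  have h22 : inner ℂ u₂ u₂ = (1 : ℂ) := by rw [inner_self_eq_norm_sq_to_K, hu₂]; simp
  have hsymm := frameOperator_isSymmetric G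
  let R : E →ₗ[ℂ] E := LinearMap.id + (innerₛₗ ℂ u₁).smulRight (v₁ - u₁) +
    (innerₛₗ ℂ u₂).smulRight (v₂ - u₂)
  have hR : ∀ x, R x = replaceVectors u₁ u₂ v₁ v₂ x := fun x => by simp [R, replaceVectors]
  -- This is `R* x`.
  set x' : E := x + inner ℂ (v₁ - u₁) x • u₁ + inner ℂ (v₂ - u₂) x • u₂ with hx'
  have hadj : ∀ g, inner ℂ (R g) x = inner ℂ g x' := fun g => by
    rw [hR, replaceVectors, hx']
    simp only [inner_add_left, inner_add_right, inner_smul_left, inner_smul_right, inner_conj_symm]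
    ring
  have h1 : frameOperator (fun i => replaceVectors u₁ u₂ v₁ v₂ (G i)) x =
      R (frameOperator G x') := by
    simp only [frameOperator_apply, ← hR, hadj, map_sum, map_smul]
  have hB₁ : inner ℂ u₁ (frameOperator G x) = z * inner ℂ u₁ x := by
    rw [← hsymm, hz₁, inner_smul_left, Complex.conj_ofReal]
  have hB₂ : inner ℂ u₂ (frameOperator G x) = z * inner ℂ u₂ x := by
    rw [← hsymm, hz₂, inner_smul_left, Complex.conj_ofReal]
  have hR₁ : R u₁ = v₁ := by rw [hR, replaceVectors, h11, h21]; simp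
  have hR₂ : R u₂ = v₂ := by rw [hR, replaceVectors, h12, h22]; simp
  rw [h1, hx']
  simp only [map_add, map_smul, hz₁, hz₂, hR₁, hR₂]
  rw [hR, replaceVectors, hB₁, hB₂, inner_sub_left, inner_sub_left]
  module

variable [FiniteDimensional ℂ E]

/-- `G` minimizes `tr φ(S₀ + S_G)` among the sequences of vectors with the same norms for which
`S₀ + S_G` is positive definite; `a` are the eigenvalues of `S₀ + S_G`. -/
def IsPotentialMin (φ : ℝ → ℝ) (S₀ : E →ₗ[ℂ] E) {k : ℕ} (G : Fin k → E)
    (a : Fin (finrank ℂ E) → ℝ) : Prop :=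
  ∀ G' : Fin k → E, (∀ i, ‖G' i‖ = ‖G i‖) →
    ∀ (b : OrthonormalBasis (Fin (finrank ℂ E)) ℂ E) (c : Fin (finrank ℂ E) → ℝ),
      IsEigenbasis (S₀ + frameOperator G') b c → (∀ p, 0 < c p) → ∑ p, φ (a p) ≤ ∑ p, φ (c p)

/-- The vectors of a minimizer are eigenvectors of the frame operator of the completion. -/
theorem IsPotentialMin.exists_apply_eq_smul {φ : ℝ → ℝ} (hφ : StrictConvexOn ℝ (Ioi 0) φ)
    {S₀ : E →ₗ[ℂ] E} (hS₀ : S₀.IsSymmetric) {k : ℕ} {G : Fin k → E}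
    {e : OrthonormalBasis (Fin (finrank ℂ E)) ℂ E} {a : Fin (finrank ℂ E) → ℝ}
    (he : IsEigenbasis (S₀ + frameOperator G) e a) (ha : ∀ p, 0 < a p)
    (hmin : IsPotentialMin φ S₀ G a) (i : Fin k) :
    ∃ r : ℝ, (S₀ + frameOperator G) (G i) = (r : ℂ) • G i := by
  refine exists_apply_eq_smul_of_isMin hφ (hS₀.add (frameOperator_isSymmetric G)) he ha (G i) ?_
  intro y hy b c hbc hc
  refine hmin (Function.update G i y) (fun j => ?_) b c (fun p => ?_) hc
  · by_cases hj : j = i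
    · subst hj; simpa using hy
    · rw [Function.update_of_ne hj]
  · rw [← hbc p, exchange_apply, LinearMap.add_apply, LinearMap.add_apply, frameOperator_update]
    abel

/-- Each `g_i` is an eigenvector of the symmetric operator `S₀ + S_G` with real eigenvalue, so each
summand `g_i ⊗ g_i` commutes with it. -/
theorem IsPotentialMin.commute {φ : ℝ → ℝ} (hφ : StrictConvexOn ℝ (Ioi 0) φ)
    {S₀ : E →ₗ[ℂ] E} (hS₀ : S₀.IsSymmetric) {k : ℕ} {G : Fin k → E}
    {e : OrthonormalBasis (Fin (finrank ℂ E)) ℂ E} {a : Fin (finrank ℂ E) → ℝ}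
    (he : IsEigenbasis (S₀ + frameOperator G) e a) (ha : ∀ p, 0 < a p)
    (hmin : IsPotentialMin φ S₀ G a) (x : E) :
    (S₀ + frameOperator G) (frameOperator G x) = frameOperator G ((S₀ + frameOperator G) x) := by
  rw [frameOperator_apply G x, frameOperator_apply G, map_sum]
  refine Finset.sum_congr rfl fun i _ => ?_
  obtain ⟨r, hr⟩ := hmin.exists_apply_eq_smul hφ hS₀ he ha i
  rw [map_smul, hr, ← (hS₀.add (frameOperator_isSymmetric G)) (G i) x, hr, inner_smul_left,
    Complex.conj_ofReal, smul_smul, mul_comm]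

/-- Two eigenvectors of `S_G` at the same eigenvalue cannot be eigenvectors of `S₀ + S_G` at
different eigenvalues: otherwise transferring weight between them decreases the potential. -/
theorem IsPotentialMin.not_lt {φ : ℝ → ℝ} (hφ : StrictConvexOn ℝ (Ioi 0) φ)
    {S₀ : E →ₗ[ℂ] E} (hS₀ : S₀.IsSymmetric) {k : ℕ} {G : Fin k → E}
    {e : OrthonormalBasis (Fin (finrank ℂ E)) ℂ E} {a : Fin (finrank ℂ E) → ℝ}
    (he : IsEigenbasis (S₀ + frameOperator G) e a) (ha : ∀ p, 0 < a p)
    (hmin : IsPotentialMin φ S₀ G a) {z : ℂ} (hz : z ≠ 0) {u₁ u₂ : E} (hu₁ : ‖u₁‖ = 1) (hu₂ : ‖u₂‖ = 1)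
    (hz₁ : frameOperator G u₁ = z • u₁) (hz₂ : frameOperator G u₂ = z • u₂) {c₁ c₂ : ℝ}
    (hc₁ : (S₀ + frameOperator G) u₁ = (c₁ : ℂ) • u₁)
    (hc₂ : (S₀ + frameOperator G) u₂ = (c₂ : ℂ) • u₂) : ¬ c₁ < c₂ := by
  intro hlt
  obtain ⟨g, hgmono, hg⟩ := exists_strictMonoOn_subgradient hφ
  set A := S₀ + frameOperator G with hAdef
  have hA : A.IsSymmetric := hS₀.add (frameOperator_isSymmetric G)
  have h11 : inner ℂ u₁ u₁ = (1 : ℂ) := by rw [inner_self_eq_norm_sq_to_K, hu₁]; simp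
  have h22 : inner ℂ u₂ u₂ = (1 : ℂ) := by rw [inner_self_eq_norm_sq_to_K, hu₂]; simp
  have orth : ∀ {x y : E} {r s : ℝ}, A x = (r : ℂ) • x → A y = (s : ℂ) • y → r ≠ s →
      inner ℂ x y = 0 := fun {x y r s} hx hy hrs => by
    have h1 := hA x y
    rw [hx, hy, inner_smul_left, inner_smul_right, Complex.conj_ofReal, ← sub_eq_zero,
      ← sub_mul] at h1
    exact (mul_eq_zero.1 h1).resolve_left (sub_ne_zero.2 (by exact_mod_cast hrs))
  have h12 : inner ℂ u₁ u₂ = 0 := orth hc₁ hc₂ hlt.ne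
  have h21 : inner ℂ u₂ u₁ = 0 := inner_eq_zero_symm.1 h12
  -- the eigenvalue `z` is real and positive
  obtain ⟨ζ, rfl⟩ : ∃ ζ : ℝ, z = ζ := by
    refine ⟨_, Eq.trans ?_ (inner_frameOperator_self G u₁)⟩
    rw [hz₁, inner_smul_right, h11, mul_one]
  have hζ : 0 < ζ := by
    have h1 := inner_frameOperator_self G u₁
    rw [hz₁, inner_smul_right, h11, mul_one, Complex.ofReal_inj] at h1
    exact lt_of_le_of_ne (h1 ▸ Finset.sum_nonneg fun i _ => sq_nonneg _)
      (by exact_mod_cast hz.symm)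
  have hpos : ∀ {x : E} {r : ℝ}, ‖x‖ = 1 → A x = (r : ℂ) • x → 0 < r := fun {x r} hx hr => by
    have h1 : ∑ p, ‖inner ℂ (e p) x‖ ^ 2 = 1 := by
      rw [e.sum_sq_norm_inner_right, hx, one_pow]
    obtain ⟨q, -, hq⟩ := Finset.exists_ne_zero_of_sum_ne_zero (h1.trans_ne one_ne_zero)
    rw [← he.eq_of_inner_ne_zero hA hr (p := q) (by simpa using hq)]
    exact ha q
  have hc₁pos : 0 < c₁ := hpos hu₁ hc₁
  obtain ⟨ε, hε, hεζ, hεc⟩ : ∃ ε : ℝ, 0 < ε ∧ ε < ζ ∧ 2 * ε < c₂ - c₁ := by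
    refine ⟨min ζ (c₂ - c₁) / 3, ?_, ?_, ?_⟩
    · have := lt_min hζ (sub_pos.2 hlt); linarith
    · have := min_le_left ζ (c₂ - c₁); linarith
    · have := min_le_right ζ (c₂ - c₁); linarith [sub_pos.2 hlt]
  -- The cross terms cancel in `v₁ ⊗ v₁ + v₂ ⊗ v₂ = 2s² u₁ ⊗ u₁ + 2r² u₂ ⊗ u₂`. The values of `s, r`
  -- make `v₁, v₂` unit vectors and `ζ (2s² - 1) = ε = -ζ (2r² - 1)`.
  set s : ℝ := √((ζ + ε) / (2 * ζ)) with hs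
  set r : ℝ := √((ζ - ε) / (2 * ζ)) with hr
  have hs2 : s ^ 2 = (ζ + ε) / (2 * ζ) := Real.sq_sqrt (by positivity)
  have hr2 : r ^ 2 = (ζ - ε) / (2 * ζ) :=
    Real.sq_sqrt (div_nonneg (by linarith) (by positivity))
  have hs2' : ζ * (2 * s ^ 2 - 1) = ε := by rw [hs2]; field_simp; ring
  have hr2' : ζ * (2 * r ^ 2 - 1) = -ε := by rw [hr2]; field_simp; ring
  have hsr : s ^ 2 + r ^ 2 = 1 := by rw [hs2, hr2]; field_simp; ring
  set v₁ : E := (s : ℂ) • u₁ + (r : ℂ) • u₂ with hv₁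
  set v₂ : E := (s : ℂ) • u₁ - (r : ℂ) • u₂ with hv₂
  have hv₁n : ‖v₁‖ = 1 := by
    have h1 : inner ℂ v₁ v₁ = ((s ^ 2 + r ^ 2 : ℝ) : ℂ) := by
      simp only [hv₁, inner_add_left, inner_add_right, inner_smul_left, inner_smul_right, h11, h12,
        h21, h22, Complex.conj_ofReal]
      push_cast
      ring
    have h2 : ‖v₁‖ ^ 2 = 1 := by
      rw [inner_self_eq_norm_sq_to_K, hsr] at h1
      rw [← Complex.ofReal_inj, Complex.ofReal_pow]
      exact h1
    exact (sq_eq_sq₀ (norm_nonneg _) zero_le_one).1 (by rw [h2, one_pow])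
  have hv₂n : ‖v₂‖ = 1 := by
    have h1 : inner ℂ v₂ v₂ = ((s ^ 2 + r ^ 2 : ℝ) : ℂ) := by
      simp only [hv₂, inner_sub_left, inner_sub_right, inner_smul_left, inner_smul_right, h11, h12,
        h21, h22, Complex.conj_ofReal]
      push_cast
      ring
    have h2 : ‖v₂‖ ^ 2 = 1 := by
      rw [inner_self_eq_norm_sq_to_K, hsr] at h1
      rw [← Complex.ofReal_inj, Complex.ofReal_pow]
      exact h1
    exact (sq_eq_sq₀ (norm_nonneg _) zero_le_one).1 (by rw [h2, one_pow])
  set G' : Fin k → E := fun i => replaceVectors u₁ u₂ v₁ v₂ (G i) with hG'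
  have hnorm : ∀ i, ‖G' i‖ = ‖G i‖ := fun i => by
    obtain ⟨ρ, hρ⟩ := hmin.exists_apply_eq_smul hφ hS₀ he ha i
    rw [hG']
    simp only [replaceVectors]
    -- `G i` is an eigenvector of `A` and `c₁ ≠ c₂`, so it is orthogonal to `u₁` or `u₂` and only
    -- one component is replaced.
    by_cases hρ1 : c₁ = ρ
    · have h2 : inner ℂ u₂ (G i) = 0 := orth hc₂ hρ (by rw [← hρ1]; exact hlt.ne')
      rw [h2, zero_smul, add_zero]
      refine norm_add_inner_smul_sub hu₁ hv₁n ?_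
      rw [hv₁]
      simp only [inner_add_left, inner_smul_left, h2, h11, h21]
      ring
    · have h1 : inner ℂ u₁ (G i) = 0 := orth hc₁ hρ hρ1
      rw [h1, zero_smul, add_zero]
      refine norm_add_inner_smul_sub hu₂ hv₂n ?_
      rw [hv₂]
      simp only [inner_sub_left, inner_smul_left, h1, h22, h12]
      ring
  have hA' : ∀ x, (S₀ + frameOperator G') x =
      A x + (ε : ℂ) • (inner ℂ u₁ x • u₁ - inner ℂ u₂ x • u₂) := fun x => by
    have h1 : (ζ : ℂ) * (2 * (s : ℂ) ^ 2 - 1) = ε := by exact_mod_cast hs2'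
    have h2 : (ζ : ℂ) * (2 * (r : ℂ) ^ 2 - 1) = -ε := by exact_mod_cast hr2'
    rw [LinearMap.add_apply, hAdef, LinearMap.add_apply, hG',
      frameOperator_replaceVectors G hu₁ hu₂ h12 hz₁ hz₂, hv₁, hv₂, add_assoc]
    simp only [inner_add_left, inner_sub_left, inner_smul_left, Complex.conj_ofReal]
    have h3 : (ε : ℂ) • (inner ℂ u₁ x • u₁ - inner ℂ u₂ x • u₂) =
        ((ζ : ℂ) * (2 * (s : ℂ) ^ 2 - 1)) • inner ℂ u₁ x • u₁ +
          ((ζ : ℂ) * (2 * (r : ℂ) ^ 2 - 1)) • inner ℂ u₂ x • u₂ := by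
      rw [h1, h2]; module
    rw [h3]
    module
  have hsym' : (S₀ + frameOperator G').IsSymmetric := hS₀.add (frameOperator_isSymmetric G')
  have heig := isEigenbasis_eigenvectorBasis hsym'
  set v := hsym'.eigenvectorBasis rfl with hv
  set c := hsym'.eigenvalues rfl with hc
  have hA'₁ : (S₀ + frameOperator G') u₁ = ((c₁ + ε : ℝ) : ℂ) • u₁ := by
    rw [hA', hc₁, h11, h21]; push_cast; module
  have hA'₂ : (S₀ + frameOperator G') u₂ = ((c₂ - ε : ℝ) : ℂ) • u₂ := by
    rw [hA', hc₂, h22, h12]; push_cast; module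
  have hcu₁ : ∀ p, inner ℂ (v p) u₁ ≠ 0 → c p = c₁ + ε := fun p hp =>
    heig.eq_of_inner_ne_zero hsym' hA'₁ hp
  have hcu₂ : ∀ p, inner ℂ (v p) u₂ ≠ 0 → c p = c₂ - ε := fun p hp =>
    heig.eq_of_inner_ne_zero hsym' hA'₂ hp
  have hcpos : ∀ p, 0 < c p := fun p => by
    by_cases h1 : inner ℂ (v p) u₁ = 0
    · by_cases h2 : inner ℂ (v p) u₂ = 0
      · refine hpos (v.norm_eq_one p) (Eq.trans ?_ (heig p))
        rw [hA', inner_eq_zero_symm.1 h1, inner_eq_zero_symm.1 h2]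
        simp
      · rw [hcu₂ p h2]; linarith
    · rw [hcu₁ p h1]; linarith
  have hklein := klein_inequality hg he heig ha hcpos
  have hle := hmin G' hnorm v c heig hcpos
  have hterm : ∀ p, g (c p) * (inner ℂ (v p) ((A - (S₀ + frameOperator G')) (v p))).re =
      ε * g (c₂ - ε) * ‖inner ℂ (v p) u₂‖ ^ 2 - ε * g (c₁ + ε) * ‖inner ℂ (v p) u₁‖ ^ 2 :=
    fun p => by
    have h1 : (inner ℂ (v p) ((A - (S₀ + frameOperator G')) (v p))).re =
        ε * (‖inner ℂ (v p) u₂‖ ^ 2 - ‖inner ℂ (v p) u₁‖ ^ 2) := by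
      rw [LinearMap.sub_apply, hA', sub_add_cancel_left, inner_neg_right, inner_smul_right,
        inner_sub_right, inner_smul_right, inner_smul_right, ← inner_conj_symm u₁,
        ← inner_conj_symm u₂, Complex.conj_mul', Complex.conj_mul']
      rw [Complex.neg_re, Complex.re_ofReal_mul, ← Complex.ofReal_pow, ← Complex.ofReal_pow,
        ← Complex.ofReal_sub, Complex.ofReal_re]
      ring
    have e₁ : g (c p) * ‖inner ℂ (v p) u₁‖ ^ 2 = g (c₁ + ε) * ‖inner ℂ (v p) u₁‖ ^ 2 := by
      by_cases h : inner ℂ (v p) u₁ = 0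
      · simp [h]
      · rw [hcu₁ p h]
    have e₂ : g (c p) * ‖inner ℂ (v p) u₂‖ ^ 2 = g (c₂ - ε) * ‖inner ℂ (v p) u₂‖ ^ 2 := by
      by_cases h : inner ℂ (v p) u₂ = 0
      · simp [h]
      · rw [hcu₂ p h]
    rw [h1]
    linear_combination ε * e₂ - ε * e₁
  simp only [hterm, Finset.sum_sub_distrib, ← Finset.mul_sum, v.sum_sq_norm_inner_right, hu₁,
    hu₂] at hklein
  have hgε : g (c₁ + ε) < g (c₂ - ε) :=
    hgmono (show 0 < c₁ + ε by linarith) (show 0 < c₂ - ε by linarith) (by linarith)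
  have := mul_pos hε (sub_pos.2 hgε)
  linarith

/-- The eigenspaces of `S_G` at nonzero eigenvalues are contained in eigenspaces of `S₀`. -/
theorem IsPotentialMin.exists_forall_apply_eq {φ : ℝ → ℝ} (hφ : StrictConvexOn ℝ (Ioi 0) φ)
    {S₀ : E →ₗ[ℂ] E} (hS₀ : S₀.IsSymmetric) {k : ℕ} {G : Fin k → E}
    {e : OrthonormalBasis (Fin (finrank ℂ E)) ℂ E} {a : Fin (finrank ℂ E) → ℝ}
    (he : IsEigenbasis (S₀ + frameOperator G) e a) (ha : ∀ p, 0 < a p)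
    (hmin : IsPotentialMin φ S₀ G a) {z : ℂ} (hz : z ≠ 0) :
    ∃ w : ℂ, ∀ x, frameOperator G x = z • x → S₀ x = w • x := by
  have hA := hS₀.add (frameOperator_isSymmetric G)
  set V := End.eigenspace (frameOperator G) z with hV
  -- Commutation allows `A` to be diagonalized inside the eigenspace, where `not_lt` leaves room for
  -- a single eigenvalue.
  have hinv : ∀ x ∈ V, (S₀ + frameOperator G) x ∈ V := fun x hx => by
    rw [hV, End.mem_eigenspace_iff] at hx ⊢
    rw [← hmin.commute hφ hS₀ he ha, hx, map_smul]
  have hsym := hA.restrict_invariant hinv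
  have heig := isEigenbasis_eigenvectorBasis hsym
  set b := hsym.eigenvectorBasis rfl
  set c := hsym.eigenvalues rfl
  have hbA : ∀ p, (S₀ + frameOperator G) (b p : E) = (c p : ℂ) • (b p : E) := fun p =>
    congrArg Subtype.val (heig p)
  have hbV : ∀ p, frameOperator G (b p : E) = z • (b p : E) := fun p =>
    End.mem_eigenspace_iff.1 (b p).2
  have hbn : ∀ p, ‖(b p : E)‖ = 1 := fun p => b.norm_eq_one p
  have hceq : ∀ p q, c p = c q := fun p q => le_antisymm
    (_root_.not_lt.1 (hmin.not_lt hφ hS₀ he ha hz (hbn q) (hbn p) (hbV q) (hbV p) (hbA q) (hbA p)))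
    (_root_.not_lt.1 (hmin.not_lt hφ hS₀ he ha hz (hbn p) (hbn q) (hbV p) (hbV q) (hbA p) (hbA q)))
  obtain ⟨μ, hμ⟩ : ∃ μ : ℝ, ∀ p, c p = μ := by
    rcases isEmpty_or_nonempty (Fin (finrank ℂ V)) with h | ⟨⟨p⟩⟩
    · exact ⟨0, fun p => h.elim p⟩
    · exact ⟨c p, fun q => hceq q p⟩
  refine ⟨μ - z, fun x hx => ?_⟩
  have hx' : (S₀ + frameOperator G) x = (μ : ℂ) • x := by
    have h1 : x = ∑ p, inner ℂ (b p) (⟨x, End.mem_eigenspace_iff.2 hx⟩ : V) • (b p : E) := by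
      have := congrArg Subtype.val (b.sum_repr' (⟨x, End.mem_eigenspace_iff.2 hx⟩ : V))
      simpa using this.symm
    conv_lhs => rw [h1]
    conv_rhs => rw [h1]
    rw [map_sum, Finset.smul_sum]
    refine Finset.sum_congr rfl fun p _ => ?_
    rw [map_smul, hbA, hμ, smul_comm]
  rw [LinearMap.add_apply, hx] at hx'
  rw [sub_smul, ← hx', add_sub_cancel_right]

end FrameCompletion

/-! ### Extended values, and reduction to the complement of the kernel. -/

namespace FrameCompletion

open Module Set Filter Topology

theorem StrictConvexOnNonneg.ne_top {f : ℝ → EReal} (hf : StrictConvexOnNonneg f) {x : ℝ}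
    (hx : 0 < x) : f x ≠ ⊤ := by
  -- A point `x > 0` is the midpoint of two distinct nonnegative points, and a strict upper bound
  -- excludes `⊤`.
  have h := hf.2 (x / 2) (3 * x / 2) (by positivity) (by positivity) (by linarith) (1 / 2) (1 / 2)
    (by norm_num) (by norm_num) (by norm_num)
  rw [show 1 / 2 * (x / 2) + 1 / 2 * (3 * x / 2) = x by ring] at h
  exact (h.trans_le le_top).ne

theorem StrictConvexOnNonneg.coe_toReal {f : ℝ → EReal} (hf : StrictConvexOnNonneg f) {x : ℝ}
    (hx : 0 < x) : ((f x).toReal : EReal) = f x :=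
  EReal.coe_toReal (hf.ne_top hx) (hf.1 x hx.le)

theorem StrictConvexOnNonneg.sum_eq_coe {f : ℝ → EReal} (hf : StrictConvexOnNonneg f) {ι : Type*}
    (s : Finset ι) {c : ι → ℝ} (hc : ∀ p, 0 < c p) :
    ∑ p ∈ s, f (c p) = ((∑ p ∈ s, (f (c p)).toReal : ℝ) : EReal) := by
  classical
  induction s using Finset.induction_on with
  | empty => simp
  | insert p s hp ih =>
    rw [Finset.sum_insert hp, Finset.sum_insert hp, ih, EReal.coe_add, hf.coe_toReal (hc p)]

theorem StrictConvexOnNonneg.strictConvexOn_toReal {f : ℝ → EReal} (hf : StrictConvexOnNonneg f) :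
    StrictConvexOn ℝ (Ioi 0) fun x => (f x).toReal := by
  refine ⟨convex_Ioi 0, fun x (hx : 0 < x) y (hy : 0 < y) hxy a b ha hb hab => ?_⟩
  have h := hf.2 x y hx.le hy.le hxy a b ha hb hab
  have hpos : 0 < a * x + b * y := by positivity
  rw [← hf.coe_toReal hx, ← hf.coe_toReal hy, ← hf.coe_toReal hpos] at h
  exact_mod_cast h

variable {H : Type*} [NormedAddCommGroup H] [InnerProductSpace ℂ H]

theorem frameOperator_append {n k : ℕ} (F : Fin n → H) (G : Fin k → H) :
    frameOperator (Fin.append F G) = frameOperator F + frameOperator G := by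
  ext x
  simp [frameOperator_apply, Fin.sum_univ_add]

theorem frameOperator_eq_zero_iff {n : ℕ} {F : Fin n → H} {x : H} :
    frameOperator F x = 0 ↔ ∀ i, inner ℂ (F i) x = 0 :=
  ⟨fun h => eq_zero_of_frameOperator_eq_zero h, fun h => by simp [frameOperator_apply, h]⟩

theorem IsEigenbasis.pos {ι : Type*} [Fintype ι] {n : ℕ} {F : Fin n → H}
    (hF : ∀ x, frameOperator F x = 0 → x = 0) {b : OrthonormalBasis ι ℂ H} {c : ι → ℝ}
    (h : IsEigenbasis (frameOperator F) b c) (p : ι) : 0 < c p := by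
  refine lt_of_le_of_ne ?_ fun h0 => ?_
  · rw [h.eigenvalue_eq, inner_frameOperator_self, Complex.ofReal_re]
    exact Finset.sum_nonneg fun i _ => sq_nonneg _
  · have h1 := hF (b p) (by rw [h p, ← h0]; simp)
    have h2 := b.norm_eq_one p
    rw [h1, norm_zero] at h2
    exact zero_ne_one h2

theorem coe_frameOperator {K : Submodule ℂ H} {n : ℕ} (F : Fin n → K) (x : K) :
    (frameOperator F x : H) = frameOperator (fun i => (F i : H)) x := by
  simp [frameOperator_apply]

variable [FiniteDimensional ℂ H]

theorem convexPotential_eq_sum {ι : Type*} [Fintype ι] {f : ℝ → EReal} {n : ℕ} {F : Fin n → H}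
    {b : OrthonormalBasis ι ℂ H} {c : ι → ℝ} (h : IsEigenbasis (frameOperator F) b c) :
    convexPotential f F = ∑ p, f (c p) :=
  (isEigenbasis_eigenvectorBasis (frameOperator_isSymmetric F)).sum_eq h f

/-- The potential of a sequence of vectors of a subspace. -/
theorem convexPotential_coe_eq_sum (K : Submodule ℂ H) {f : ℝ → EReal} {n : ℕ} {F : Fin n → K}
    {b : OrthonormalBasis (Fin (finrank ℂ K)) ℂ K} {c : Fin (finrank ℂ K) → ℝ}
    (h : IsEigenbasis (frameOperator F) b c) :
    convexPotential f (fun i => (F i : H)) = ∑ p, f (c p) + finrank ℂ Kᗮ • f 0 := by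
  let b' := stdOrthonormalBasis ℂ Kᗮ
  let v : Fin (finrank ℂ K) ⊕ Fin (finrank ℂ Kᗮ) → H :=
    Sum.elim (fun p => (b p : H)) (fun q => (b' q : H))
  have hv : Orthonormal ℂ v := by
    have hb := b.orthonormal
    have hb' := b'.orthonormal
    rw [orthonormal_iff_ite] at hb hb' ⊢
    rintro (i | i) (j | j)
    · simpa [v] using hb i j
    · simpa [v] using Submodule.inner_right_of_mem_orthogonal (b i).2 (b' j).2
    · simpa [v] using Submodule.inner_left_of_mem_orthogonal (b j).2 (b' i).2
    · simpa [v] using hb' i j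
  obtain ⟨B, hB⟩ := Orthonormal.exists_orthonormalBasis_extension_of_card_eq (𝕜 := ℂ) (v := v)
    (s := univ) (by simp [Submodule.finrank_add_finrank_orthogonal])
    (hv.comp _ Subtype.val_injective)
  replace hB : ∀ p, B p = v p := fun p => hB p (mem_univ p)
  have heig : IsEigenbasis (frameOperator fun i => (F i : H)) B (Sum.elim c fun _ => 0) := by
    rintro (p | q)
    · rw [hB]
      simp only [v, Sum.elim_inl]
      rw [← coe_frameOperator, h p, Submodule.coe_smul]
    · rw [hB]
      simp only [v, Sum.elim_inr, Complex.ofReal_zero, zero_smul]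
      exact frameOperator_eq_zero_iff.2 fun i =>
        Submodule.inner_right_of_mem_orthogonal (F i).2 (b' q).2
  rw [convexPotential_eq_sum heig, Fintype.sum_sum_type]
  simp

/-- Initial data have a completion whose frame operator is invertible. -/
theorem IsInitialData.exists_completion [Nontrivial H] {n₀ k : ℕ} {F₀ : Fin n₀ → H}
    {a : Fin k → ℝ} (hdata : IsInitialData F₀ a) :
    ∃ F ∈ completions F₀ a, ∀ x, frameOperator F x = 0 → x = 0 := by
  classical
  obtain ⟨u, hu⟩ := exists_norm_eq H zero_le_one
  set N := LinearMap.ker (frameOperator F₀) with hN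
  have hNk : finrank ℂ N ≤ k := by
    have h1 := (frameOperator F₀).finrank_range_add_finrank_ker
    have h2 := hdata.2
    rw [← hN] at h1
    omega
  let o := stdOrthonormalBasis ℂ N
  -- An orthonormal basis of `ker S_{F₀}` fits into the `k` slots by the rank condition; `u` fills
  -- the remaining ones.
  let g : Fin k → H := fun i =>
    if h : (i : ℕ) < finrank ℂ N then (o ⟨i, h⟩ : H) else u
  have hg : ∀ i, ‖g i‖ = 1 := fun i => by
    simp only [g]
    split_ifs with h
    · exact o.norm_eq_one ⟨i, h⟩
    · exact hu
  refine ⟨Fin.append F₀ fun i => ((√(a i) : ℝ) : ℂ) • g i, ⟨fun i => by simp, fun i => ?_⟩,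
    fun x hx => ?_⟩
  · rw [Fin.append_right, norm_smul, hg, mul_one, Complex.norm_real, Real.norm_eq_abs, sq_abs,
      Real.sq_sqrt (hdata.1 i).le]
  · rw [frameOperator_eq_zero_iff] at hx
    have hxN : x ∈ N := by
      rw [hN, LinearMap.mem_ker, frameOperator_eq_zero_iff]
      exact fun i => by simpa using hx (Fin.castAdd k i)
    have hxo : ∀ j, inner ℂ (o j) (⟨x, hxN⟩ : N) = 0 := fun j => by
      have h1 := hx (Fin.natAdd n₀ ⟨j, j.2.trans_le hNk⟩)
      rw [Fin.append_right, inner_smul_left, Complex.conj_ofReal] at h1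
      have h2 := (mul_eq_zero.1 h1).resolve_left
        (by exact_mod_cast (Real.sqrt_pos.2 (hdata.1 _)).ne')
      simpa [g] using h2
    have h3 := o.sum_repr' (⟨x, hxN⟩ : N)
    simp only [hxo, zero_smul, Finset.sum_const_zero] at h3
    exact (congrArg Subtype.val h3).symm

/-- A completion with invertible frame operator involves `f` only on `(0, ∞)`, hence has finite
potential, and it bounds the minimum. -/
theorem ne_top_of_isMinOn {n₀ k : ℕ} {F₀ : Fin n₀ → H} {a : Fin k → ℝ}
    (hdata : IsInitialData F₀ a) {f : ℝ → EReal} (hf : StrictConvexOnNonneg f)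
    {F : Fin (n₀ + k) → H} (hmin : IsMinOn (convexPotential f) (completions F₀ a) F) :
    convexPotential f F ≠ ⊤ := by
  rcases subsingleton_or_nontrivial H with hH | hH
  · have : finrank ℂ H = 0 := finrank_zero_of_subsingleton
    have hempty : IsEmpty (Fin (finrank ℂ H)) := by rw [this]; infer_instance
    simp [convexPotential]
  · obtain ⟨F', hF', hinj⟩ := hdata.exists_completion
    refine ((isMinOn_iff.1 hmin F' hF').trans_lt ?_).ne
    have heig := isEigenbasis_eigenvectorBasis (frameOperator_isSymmetric F')
    rw [convexPotential_eq_sum heig, hf.sum_eq_coe _ (heig.pos hinj)]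
    exact EReal.coe_lt_top _

/-- The eigenspaces of `S_G` at nonzero eigenvalues are contained in eigenspaces of `S_{F₀}`, for a
minimizer `(F₀, G)`. -/
theorem exists_forall_apply_eq_of_isMinOn {n₀ k : ℕ} {F₀ : Fin n₀ → H} {a : Fin k → ℝ}
    (hdata : IsInitialData F₀ a) {f : ℝ → EReal} (hf : StrictConvexOnNonneg f) {G : Fin k → H}
    (hmem : Fin.append F₀ G ∈ completions F₀ a)
    (hmin : IsMinOn (convexPotential f) (completions F₀ a) (Fin.append F₀ G)) {z : ℂ}
    (hz : z ≠ 0) : ∃ w : ℂ, ∀ x, frameOperator G x = z • x → frameOperator F₀ x = w • x := by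
  set N := LinearMap.ker (frameOperator (Fin.append F₀ G)) with hN
  set K := Nᗮ with hK
  have hNinner : ∀ x ∈ N, (∀ i, inner ℂ (F₀ i) x = 0) ∧ ∀ i, inner ℂ (G i) x = 0 :=
    fun x hx => by
      rw [hN, LinearMap.mem_ker, frameOperator_eq_zero_iff] at hx
      exact ⟨fun i => by simpa using hx (Fin.castAdd k i),
        fun i => by simpa using hx (Fin.natAdd n₀ i)⟩
  have hF₀K : ∀ i, F₀ i ∈ K := fun i =>
    (Submodule.mem_orthogonal' N _).2 fun x hx => (hNinner x hx).1 i
  have hGK : ∀ i, G i ∈ K := fun i =>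
    (Submodule.mem_orthogonal' N _).2 fun x hx => (hNinner x hx).2 i
  let F₁ : Fin n₀ → K := fun i => ⟨F₀ i, hF₀K i⟩
  let G₁ : Fin k → K := fun i => ⟨G i, hGK i⟩
  have hcoe : ∀ G' : Fin k → K, (fun i => ((Fin.append F₁ G' i : K) : H)) =
      Fin.append F₀ fun i => (G' i : H) := fun G' => by
    funext i
    refine Fin.addCases (fun i => ?_) (fun i => ?_) i <;> simp [F₁]
  have hinj : ∀ x, frameOperator (Fin.append F₁ G₁) x = 0 → x = 0 := fun x hx => by
    have h1 : (x : H) ∈ N := by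
      rw [hN, LinearMap.mem_ker, ← show (fun i => ((Fin.append F₁ G₁ i : K) : H)) = Fin.append F₀ G from
        hcoe G₁, ← coe_frameOperator, hx, Submodule.coe_zero]
    have h2 := Submodule.inner_right_of_mem_orthogonal h1 x.2
    exact Subtype.ext (inner_self_eq_zero.1 h2)
  have heig := isEigenbasis_eigenvectorBasis (frameOperator_isSymmetric (Fin.append F₁ G₁))
  set e := (frameOperator_isSymmetric (Fin.append F₁ G₁)).eigenvectorBasis rfl
  set α := (frameOperator_isSymmetric (Fin.append F₁ G₁)).eigenvalues rfl
  have hα : ∀ p, 0 < α p := heig.pos hinj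
  have hpot := convexPotential_coe_eq_sum K (f := f) heig
  rw [hcoe] at hpot
  -- The kernel term must be finite before it can be cancelled in `EReal`. If the kernel is nonzero
  -- and `f 0 = ⊤`, the minimal potential would be `⊤`.
  have hfin : ∃ r : ℝ, finrank ℂ Kᗮ • f 0 = r := by
    rcases Nat.eq_zero_or_pos (finrank ℂ Kᗮ) with h0 | hpos
    · exact ⟨0, by simp [h0]⟩
    · have h1 : f 0 ≠ ⊤ := fun htop => by
        refine ne_top_of_isMinOn hdata hf hmin (hpot.trans ?_)
        rw [hf.sum_eq_coe _ hα, htop, EReal.nsmul_eq_mul, EReal.mul_top_of_pos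
          (by exact_mod_cast hpos), EReal.coe_add_top]
      refine ⟨finrank ℂ Kᗮ • (f 0).toReal, ?_⟩
      rw [EReal.coe_nsmul, EReal.coe_toReal h1 (hf.1 0 le_rfl)]
  obtain ⟨r, hr⟩ := hfin
  have hmin₁ : IsPotentialMin (fun x => (f x).toReal) (frameOperator F₁) G₁ α := by
    intro G' hG' b c hbc hc
    rw [← frameOperator_append] at hbc
    have hpot' := convexPotential_coe_eq_sum K (f := f) hbc
    rw [hcoe] at hpot'
    have hmem' : (Fin.append F₀ fun i => (G' i : H)) ∈ completions F₀ a := by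
      refine ⟨fun i => by simp, fun i => ?_⟩
      have h1 := hmem.2 i
      rw [Fin.append_right] at h1 ⊢
      rw [← h1]
      exact congrArg (· ^ 2) (hG' i)
    have hle := isMinOn_iff.1 hmin _ hmem'
    rw [show convexPotential f (Fin.append F₀ G) = _ from hpot, hpot', hr, hf.sum_eq_coe _ hα,
      hf.sum_eq_coe _ hc] at hle
    have hle' : ∑ p, (f (α p)).toReal + r ≤ ∑ p, (f (c p)).toReal + r := by exact_mod_cast hle
    exact le_of_add_le_add_right hle'
  rw [frameOperator_append] at heig
  obtain ⟨w, hw⟩ := hmin₁.exists_forall_apply_eq hf.strictConvexOn_toReal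
    (frameOperator_isSymmetric F₁) heig hα hz
  refine ⟨w, fun x hx => ?_⟩
  -- Since `z ≠ 0`, the `z`-eigenvectors of `S_G` are orthogonal to `ker S_G`, which contains `N`;
  -- none is lost by restricting to `K`.
  have hxK : x ∈ K := by
    refine (Submodule.mem_orthogonal N _).2 fun y hy => ?_
    have h1 := frameOperator_isSymmetric G y x
    rw [frameOperator_eq_zero_iff.2 (hNinner y hy).2, inner_zero_left, hx, inner_smul_right] at h1
    exact (mul_eq_zero.1 h1.symm).resolve_left hz
  have h1 := hw ⟨x, hxK⟩ (Subtype.ext (by rw [coe_frameOperator]; exact hx))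
  have h2 := congrArg Subtype.val h1
  rw [coe_frameOperator] at h2
  exact h2

theorem IsSubprojection.range_le {S P : H →ₗ[ℂ] H} {z : ℂ}
    (hP : IsSubprojection P (spectralProjection S z)) :
    LinearMap.range P ≤ LinearMap.ker (S - algebraMap ℂ (End ℂ H) z) := by
  have hQ : (spectralProjection S z).IsSymmetricProjection :=
    Submodule.isSymmetricProjection_starProjection _
  have h := (hP.1.le_iff_range_le_range hQ).1 hP.2
  simpa [spectralProjection] using h

end FrameCompletion

/-! ### Conclusion for spectra and sub-projections. -/

theorem mainTheorem11 {H : Type*} [NormedAddCommGroup H] [InnerProductSpace ℂ H]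
    [FiniteDimensional ℂ H] {n₀ k : ℕ} (F₀ : Fin n₀ → H) (a : Fin k → ℝ)
    (hdata : FrameCompletion.IsInitialData F₀ a)
    (f : ℝ → EReal) (hf : FrameCompletion.StrictConvexOnNonneg f)
    (G : Fin k → H)
    (hmem : Fin.append F₀ G ∈ FrameCompletion.completions F₀ a)
    (hmin : IsMinOn (FrameCompletion.convexPotential f) (FrameCompletion.completions F₀ a)
      (Fin.append F₀ G))
    (z : ℂ) (hz : z ∈ spectrum ℂ (FrameCompletion.frameOperator G)) (hz0 : z ≠ 0) :
    (∃ w ∈ spectrum ℂ (FrameCompletion.frameOperator F₀),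
      LinearMap.ker (FrameCompletion.frameOperator G - algebraMap ℂ (Module.End ℂ H) z) ≤
        LinearMap.ker (FrameCompletion.frameOperator F₀ - algebraMap ℂ (Module.End ℂ H) w)) ∧
    ∀ P : H →ₗ[ℂ] H,
      FrameCompletion.IsSubprojection P
        (FrameCompletion.spectralProjection (FrameCompletion.frameOperator G) z) →
      P ∘ₗ FrameCompletion.frameOperator F₀ = FrameCompletion.frameOperator F₀ ∘ₗ P := by
  obtain ⟨w, hw⟩ :=
    FrameCompletion.exists_forall_apply_eq_of_isMinOn hdata hf hmem hmin hz0
  have hmemker : ∀ (S : H →ₗ[ℂ] H) (μ : ℂ) (x : H),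
      x ∈ LinearMap.ker (S - algebraMap ℂ (Module.End ℂ H) μ) ↔ S x = μ • x := fun S μ x => by
    rw [LinearMap.mem_ker, LinearMap.sub_apply, Module.algebraMap_end_apply, sub_eq_zero]
  -- A nonzero eigenvector at `z` is needed to put `w` in the spectrum of `S₀`.
  obtain ⟨x, hx⟩ := (Module.End.hasEigenvalue_iff_mem_spectrum.2 hz).exists_hasEigenvector
  have hweig : Module.End.HasEigenvalue (FrameCompletion.frameOperator F₀) w :=
    Module.End.hasEigenvalue_of_hasEigenvector (x := x)
      ⟨Module.End.mem_eigenspace_iff.2 (hw x hx.apply_eq_smul), hx.2⟩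
  refine ⟨⟨w, Module.End.hasEigenvalue_iff_mem_spectrum.1 hweig, fun y hy => ?_⟩,
    fun P hP => ?_⟩
  · rw [hmemker] at hy ⊢
    exact hw y hy
  · have hS₀ := FrameCompletion.frameOperator_isSymmetric F₀
    have hSP : ∀ y, FrameCompletion.frameOperator F₀ (P y) = w • P y := fun y =>
      hw _ ((hmemker _ _ _).1 (hP.range_le (LinearMap.mem_range_self P y)))
    -- Taking adjoints in `S₀ P = w P`, with `w` real, gives `P S₀ = w P`.
    refine LinearMap.ext fun y => ext_inner_right ℂ fun v => ?_
    rw [LinearMap.comp_apply, LinearMap.comp_apply, hSP, hP.1.isSymmetric, hS₀, hSP,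
      inner_smul_right, inner_smul_left, hS₀.conj_eigenvalue_eq_self hweig, hP.1.isSymmetric]
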